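/- Let $p_0=(0,0)$, $p_1=(1,0)$, $p_2=(\tfrac12,\tfrac{\sqrt3}{2})$ be the vertices of an equilateral triangle in $\mathbb R^2$, and let $F$ be the linear contraction of $\mathbb R^2$ with fixed point $(0,0)$ and matrix $$\begin{pmatrix}\tfrac12&\tfrac{\sqrt3}{6}\\[2pt] \tfrac{\sqrt3}{12}&\tfrac14\end{pmatrix},$$ so that $F(p_0)=p_0$, $F(p_1)=\tfrac{5}{12}p_0+\tfrac5{12}p_1+\tfrac16p_2$ and $F(p_2)=\tfrac13(p_0+p_1+p_2)$. (In the coordinates $(x,\sqrt3\,y)$ its matrix is $\begin{pmatrix}1/2&1/6\\1/4&1/4\end{pmatrix}$.) For each of the six symmetries $g_\sigma$ of the triangle, where $\sigma$ is a permutation of $\{0,1,2\}$ and $g_\sigma(p_i)=p_{\sigma(i)}$, put $F_\sigma=g_\sigma\circ F\circ g_\sigma^{-1}$. These six affine contractions define the non-p.c.f. analog of the Sierpiński gasket. For $n\ge 0$ and a word $\omega=\omega_1\cdots\omega_n$ in the six symbols let $F_\omega=F_{\omega_1}\circ\cdots\circ F_{\omega_n}$ (the identity for $n=0$). The $n$-th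 approximating graph $G_n$ is the finite multigraph whose vertex set is $V_n=\bigcup_{|\omega|=n}F_\omega(\{p_0,p_1,p_2\})$ and which has, for every word $\omega$ of length $n$ and every pair $0\le a<b\le2$, one edge between $F_\omega(p_a)$ and $F_\omega(p_b)$; edges coming from different pairs $(\omega,\{a,b\})$ are different, so that parallel edges occur. Let $\tau(G_n)$ be the number of spanning trees of the multigraph $G_n$, parallel edges being distinguished. **Theorem.** For every $n\ge 0$ the numbers $$f_n=\tfrac{2}{25}\left(11\cdot 6^n-30n-11\right),\qquad g_n=\tfrac15\left(2\cdot 6^n+3\right),\qquad h_n=\tfrac1{25}\left(4\cdot 6^n+30n-4\right)$$ are non-negative integers, and $$\tau(G_n)=2^{f_n}\cdot 3^{g_n}\cdot 5^{h_n}.$$ -/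

import Mathlib

namespace Multigraph

variable {α β : Type*}

/-- A multigraph is connected if it has a vertex and any two of its vertices are joined by a
walk. -/
def Connected (G : Graph α β) : Prop :=
  G.vertexSet.Nonempty ∧
    ∀ x ∈ G.vertexSet, ∀ y ∈ G.vertexSet, Relation.ReflTransGen G.Adj x y

/-- `G` contains a cycle: for some length `m + 1 ≥ 1` there are distinct vertices
`v 0, …, v m` and distinct edges `e 0, …, e m` such that `e i` joins `v i` and `v (i + 1)`,
indices being read modulo `m + 1`. (A loop is a cycle of length 1, two parallel edges form a cycle
of length 2.) -/
def HasCycle (G : Graph α β) : Prop :=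
  ∃ (m : ℕ) (v : Fin (m + 1) → α) (e : Fin (m + 1) → β),
    Function.Injective v ∧ Function.Injective e ∧ ∀ i, G.IsLink (e i) (v i) (v (i + 1))

/-- A tree is a connected multigraph without cycles. -/
def IsTree (G : Graph α β) : Prop := Connected G ∧ ¬ HasCycle G

/-- The number of spanning trees of a multigraph: the number of its subgraphs
which contain all its vertices and are trees. Parallel edges are distinct edges. -/
noncomputable def numSpanningTrees (G : Graph α β) : ℕ :=
  {H : Graph α β | H.IsSpanningSubgraph G ∧ IsTree H}.ncard

end Multigraph

namespace SelfSimilar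

variable {X ι κ : Type*}

/-- `wordMap f n ω = f_{ω 0} ∘ f_{ω 1} ∘ ⋯ ∘ f_{ω (n-1)}`. -/
def wordMap (f : ι → X → X) : (n : ℕ) → (Fin n → ι) → X → X
  | 0, _ => id
  | n + 1, ω => f (ω 0) ∘ wordMap f n (Fin.tail ω)

/-- The `n`-th approximating graph of the system of maps `(f i)` with boundary points `(p k)`.
Its vertex set is the union, over all words `ω` of length `n`, of the images under `f_ω` of the
boundary points. Its edges are the copies of the edges of the complete graph on the boundary
points under the maps `f_ω`: for every word `ω` and every two distinct boundary
points `p a`, `p b` there is one edge, labelled `(ω, s(a, b))`, between `f_ω (p a)` and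
`f_ω (p b)`. -/
def approxGraph (f : ι → X → X) (p : κ → X) (n : ℕ) : Graph X ((Fin n → ι) × Sym2 κ) where
  vertexSet := {x | ∃ ω a, x = wordMap f n ω (p a)}
  IsLink e x y := ∃ a b, a ≠ b ∧ e.2 = s(a, b) ∧
    x = wordMap f n e.1 (p a) ∧ y = wordMap f n e.1 (p b)
  isLink_symm := by
    rintro e -
    exact ⟨fun x y ⟨a, b, hab, he, hx, hy⟩ => ⟨b, a, hab.symm, by rw [he, Sym2.eq_swap], hy, hx⟩⟩
  eq_or_eq_of_isLink_of_isLink := by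
    rintro e x y v w ⟨a, b, -, he, rfl, rfl⟩ ⟨c, d, -, he', rfl, rfl⟩
    rw [he, Sym2.eq_iff] at he'
    rcases he' with ⟨rfl, rfl⟩ | ⟨rfl, rfl⟩
    · exact Or.inl rfl
    · exact Or.inr rfl
  left_mem_of_isLink := by
    rintro e x y ⟨a, b, -, -, rfl, -⟩
    exact ⟨_, _, rfl⟩

end SelfSimilar

namespace NonPCFGasket

/-- The Euclidean plane. -/
abbrev Plane : Type := EuclideanSpace ℝ (Fin 2)

/-- The vertices `(0, 0)`, `(1, 0)`, `(1/2, √3/2)` of an equilateral triangle. -/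
noncomputable def corner : Fin 3 → Plane :=
  ![!₂[0, 0], !₂[1, 0], !₂[1 / 2, √3 / 2]]

/-- Barycentric coordinates with respect to the triangle. -/
noncomputable def bary (x : Plane) : Fin 3 → ℝ :=
  ![1 - x 0 - x 1 / √3, x 0 - x 1 / √3, 2 * x 1 / √3]

/-- The symmetry of the equilateral triangle which permutes its vertices by `σ`. -/
noncomputable def triSymm (σ : Equiv.Perm (Fin 3)) (x : Plane) : Plane :=
  ∑ i, bary x i • corner (σ i)

/-- The linear contraction with fixed point `(0, 0)`. In the coordinates `(x, √3 y)` its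
matrix is `!![1/2, 1/6; 1/4, 1/4]`. It sends the vertex `(1, 0)` to `(1/2, √3/12)` and
the vertex `(1/2, √3/2)` to the centre `(1/2, √3/6)` of the triangle. -/
noncomputable def baseMap (x : Plane) : Plane :=
  Matrix.toEuclideanLin !![1 / 2, √3 / 6; √3 / 12, 1 / 4] x

/-- The six affine contractions of the gasket: the conjugates of `baseMap` by the six symmetries
of the triangle. -/
noncomputable def cellMap (σ : Equiv.Perm (Fin 3)) : Plane → Plane :=
  triSymm σ ∘ baseMap ∘ triSymm σ⁻¹

/-- The approximating graph `G_n` of the non-p.c.f. analog of the Sierpiński gasket. -/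
noncomputable def G (n : ℕ) :
    Graph Plane ((Fin n → Equiv.Perm (Fin 3)) × Sym2 (Fin 3)) :=
  SelfSimilar.approxGraph cellMap corner n

end NonPCFGasket

/-!
The spanning trees of `G n` are counted by the matrix tree theorem, and the determinants of the
reduced Laplacians satisfy a recursion because each triangle of `G n` is replaced in `G (n + 1)` by
a copy of the wheel-like graph `G 1`, which is electrically equivalent to a triangle.

*Matrix tree theorem* (`Multigraph.numSpanningTrees_eq_det`). Let `B` be the incidence matrix with
the column of a root deleted. A symmetrized Cauchy–Binet formula writes `det (Bᵀ * B)` as the sum of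
the squares of the maximal minors. The rows of a spanning tree form a basis of the lattice `N → ℤ`,
so its minor is `±1`; conversely a nonzero minor forces its edges to form a connected graph without
cycles.

*Vertices* (`point_injective`, `range_point`). In barycentric coordinates the map of the cell `σ`
sends the open triangle into the open chamber in which the coordinates decrease along `σ`. Hence
open cells of the same level are disjoint from the other closed cells, and each cell of level `n`
contributes exactly four new vertices to `V (n + 1)`: three points opposite to the corners, and a
centre. Therefore `V n` has `2 + 4 (6 ^ n - 1) / 5` points besides the root.

*Recursion* (`det_laplacian_succ`). After a unipotent change of basis to functions that are harmonic
at the new vertices, together with functions supported there, the Laplacian of `G (n + 1)` is block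
diagonal. One block is `5/4` times the Laplacian of `G n` (`cellForm_harmonic`); the other one
consists of `6 ^ n` copies of a `4 × 4` matrix with determinant `576`. Hence
`τ (G (n + 1)) = 576 ^ (6 ^ n) * (5 / 4) ^ (#V n - 1) * τ (G n)`, and `τ (G 0) = 3`.
-/

/-! ### A symmetrized Cauchy–Binet formula -/

namespace Matrix

/-- A symmetrized form of the Cauchy–Binet formula for `Bᵀ * B`: every square submatrix is counted
once for each ordering of its rows, and the orderings with a repeated row contribute zero. -/
theorem factorial_mul_det_transpose_mul_self {E N R : Type*} [Fintype E] [Fintype N]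
    [DecidableEq N] [CommRing R] (B : Matrix E N R) :
    ((Fintype.card N).factorial : R) * (Bᵀ * B).det =
      ∑ f : N → E, (B.submatrix f id).det ^ 2 := by
  classical
  have expand : (Bᵀ * B).det = ∑ f : N → E, (∏ i, B (f i) i) * (B.submatrix f id).det := by
    simp only [det_apply', mul_apply, transpose_apply, Finset.prod_univ_sum, Finset.mul_sum,
      Fintype.piFinset_univ, submatrix_apply, id]
    rw [Finset.sum_comm]
    refine Finset.sum_congr rfl fun f _ => ?_
    rw [← Equiv.sum_comp (Equiv.inv (Equiv.Perm N))]
    refine Finset.sum_congr rfl fun σ _ => ?_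
    rw [Finset.prod_mul_distrib]
    have h : ∏ i, B (f i) ((Equiv.inv (Equiv.Perm N)) σ i) = ∏ i, B (f (σ i)) i := by
      rw [← Equiv.prod_comp σ]
      simp
    rw [h]
    simp
    ring
  -- Reordering the rows by `τ` multiplies the minor by the sign of `τ`.
  have perm (τ : Equiv.Perm N) : (Bᵀ * B).det =
      ∑ f : N → E, (Equiv.Perm.sign τ : R) * (∏ i, B (f (τ i)) i) * (B.submatrix f id).det := by
    rw [expand, ← Equiv.sum_comp (Equiv.arrowCongr τ.symm (Equiv.refl E))]
    refine Finset.sum_congr rfl fun f _ => ?_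
    have h : B.submatrix ((Equiv.arrowCongr τ.symm (Equiv.refl E)) f) id =
        (B.submatrix f id).submatrix τ id := by
      ext i j
      simp [Equiv.arrowCongr]
    rw [h, det_permute]
    simp [Equiv.arrowCongr]
    ring
  have total : ∑ τ : Equiv.Perm N, (Bᵀ * B).det =
      ((Fintype.card N).factorial : R) * (Bᵀ * B).det := by
    simp [Fintype.card_perm]
  rw [← total, Finset.sum_congr rfl fun τ _ => perm τ, Finset.sum_comm]
  refine Finset.sum_congr rfl fun f _ => ?_
  rw [← Finset.sum_mul, sq]
  congr 1
  rw [det_apply']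
  rfl

end Matrix

/-! ### The matrix tree theorem for multigraphs -/

namespace Multigraph

variable {α β : Type*}

/-- If the ends of an edge `e₀` remain joined by a walk after `e₀` is deleted, then a shortest such
walk together with `e₀` forms a cycle. -/
theorem hasCycle_of_reflTransGen_deleteEdges {G : Graph α β} {e₀ : β} {x y : α}
    (h₀ : G.IsLink e₀ x y)
    (h : Relation.ReflTransGen (G.deleteEdges {e₀}).Adj x y) : HasCycle G := by
  let K : SimpleGraph α := SimpleGraph.fromRel (G.deleteEdges {e₀}).Adj
  have hK : K.Reachable x y := by
    clear h₀
    induction h with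
    | refl => exact SimpleGraph.Reachable.refl _
    | @tail b c _ hbc ih =>
      by_cases hne : b = c
      · exact hne ▸ ih
      · exact ih.trans (SimpleGraph.Adj.reachable ((SimpleGraph.fromRel_adj _ _ _).2
          ⟨hne, Or.inl hbc⟩))
  obtain ⟨w, hw⟩ := hK.exists_isPath
  have hlink : ∀ i : ℕ, ∃ e, i < w.length → G.IsLink e (w.getVert i) (w.getVert (i + 1)) ∧
      e ≠ e₀ := by
    intro i
    by_cases hi : i < w.length
    · obtain ⟨-, hadj⟩ := (SimpleGraph.fromRel_adj _ _ _).1 (w.adj_getVert_succ hi)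
      have hadj' : (G.deleteEdges {e₀}).Adj (w.getVert i) (w.getVert (i + 1)) :=
        hadj.elim id fun h => h.symm
      obtain ⟨e, he⟩ := hadj'
      refine ⟨e, fun _ => ⟨he.mono Graph.deleteEdges_le, ?_⟩⟩
      rintro rfl
      simp at he
    · exact ⟨e₀, fun h => absurd h hi⟩
  choose e he using hlink
  have hvinj : ∀ i j, i ≤ w.length → j ≤ w.length → w.getVert i = w.getVert j → i = j :=
    fun i j hi hj hij => hw.getVert_injOn hi hj hij
  refine ⟨w.length, fun i => w.getVert i, fun i => if (i : ℕ) < w.length then e i else e₀,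
    ?_, ?_, ?_⟩
  · intro i j hij
    exact Fin.ext (hvinj i j (by omega) (by omega) hij)
  · intro i j hij
    dsimp only at hij
    split_ifs at hij with hi hj hj
    · have h1 := (he i hi).1
      have h2 := (he j hj).1
      rw [hij] at h1
      rcases h1.eq_and_eq_or_eq_and_eq h2 with ⟨h, -⟩ | ⟨h, h'⟩
      · exact Fin.ext (hvinj i j (by omega) (by omega) h)
      · have := hvinj _ _ (by omega) (by omega) h
        have := hvinj _ _ (by omega) (by omega) h'
        omega
    · exact absurd hij (he i hi).2
    · exact absurd hij.symm (he j hj).2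
    · exact Fin.ext (by omega)
  · intro i
    dsimp only
    by_cases hi : (i : ℕ) < w.length
    · have : ((i + 1 : Fin (w.length + 1)) : ℕ) = i + 1 :=
        Fin.val_add_one_of_lt (Fin.lt_def.2 (by simpa using hi))
      rw [if_pos hi, this]
      exact (he i hi).1
    · have hlast : i = Fin.last w.length := Fin.ext (by simp; omega)
      rw [if_neg hi, hlast]
      simpa using h₀.symm

/-- The reduced incidence matrix of a multigraph whose vertices are labelled by `Option N`, the
label `none` marking the root, and in which the edge `e` runs from `s e` to `t e`. The row of `e`
is the difference of the indicators of its ends, with the entry of the root deleted. -/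
def redIncidence {E N : Type*} [DecidableEq N] (s t : E → Option N) : Matrix E N ℤ :=
  fun e v => (if s e = some v then 1 else 0) - (if t e = some v then 1 else 0)

/-- Pairing with the row of `e` computes the difference along `e` of a function `φ` on all vertices;
normalizing `φ` to vanish at the root does not change differences. -/
theorem redIncidence_mulVec {E N : Type*} [Fintype N] [DecidableEq N] (s t : E → Option N)
    (φ : Option N → ℤ) (e : E) :
    (redIncidence s t).mulVec (fun v => φ (some v) - φ none) e = φ (s e) - φ (t e) := by
  have h (o : Option N) :
      ∑ v, (if o = some v then (1 : ℤ) else 0) * (φ (some v) - φ none) = φ o - φ none := by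
    cases o <;> simp
  simp only [Matrix.mulVec, dotProduct, redIncidence, sub_mul, Finset.sum_sub_distrib, h]
  ring

section

variable {E N : Type*} [Fintype N] [DecidableEq N] {G H : Graph α β} {pt : Option N → α}
  {lab : E → β} {s t : E → Option N}

/-- In a spanning tree the rows of the reduced incidence matrix span `N → ℤ`: the indicator of a
vertex is the sum of the signed rows along a walk from the root. -/
theorem span_redIncidence_eq_top (hpt : Function.Injective pt) (hV : Set.range pt = H.vertexSet)
    (hE : H.edgeSet ⊆ Set.range lab)
    (hl : ∀ e, lab e ∈ H.edgeSet → H.IsLink (lab e) (pt (s e)) (pt (t e))) (hH : Connected H) :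
    Submodule.span ℤ ((redIncidence s t).row '' {e | lab e ∈ H.edgeSet}) = ⊤ := by
  let δ : Option N → N → ℤ := fun o v => if o = some v then 1 else 0
  have key : ∀ x, Relation.ReflTransGen H.Adj (pt none) x → ∃ o, pt o = x ∧
      δ o ∈ Submodule.span ℤ ((redIncidence s t).row '' {e | lab e ∈ H.edgeSet}) := by
    intro x hx
    induction hx with
    | refl =>
      refine ⟨none, rfl, ?_⟩
      have : δ none = 0 := by ext v; simp [δ]
      rw [this]
      exact zero_mem _
    | tail _ hbc ih =>
      obtain ⟨o, rfl, ho⟩ := ih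
      obtain ⟨b, hb⟩ := hbc
      obtain ⟨e, rfl⟩ := hE hb.edge_mem
      have hmem : δ (s e) - δ (t e) ∈
          Submodule.span ℤ ((redIncidence s t).row '' {e | lab e ∈ H.edgeSet}) :=
        Submodule.subset_span ⟨e, hb.edge_mem, rfl⟩
      rcases (hl e hb.edge_mem).eq_and_eq_or_eq_and_eq hb with ⟨h1, h2⟩ | ⟨h1, h2⟩
      · refine ⟨t e, h2, ?_⟩
        rw [hpt h1] at hmem
        simpa using sub_mem ho hmem
      · refine ⟨s e, h1, ?_⟩
        rw [hpt h2] at hmem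
        simpa using add_mem hmem ho
  rw [eq_top_iff, ← (Pi.basisFun ℤ N).span_eq, Submodule.span_le]
  rintro _ ⟨v, rfl⟩
  obtain ⟨o, ho, hmem⟩ := key (pt (some v))
    (hH.2 _ (hV ▸ ⟨_, rfl⟩) _ (hV ▸ ⟨_, rfl⟩))
  rw [hpt ho] at hmem
  have hδ : Pi.basisFun ℤ N v = δ (some v) := by
    ext w
    simp [δ, Pi.single_apply, eq_comm]
  rw [hδ]
  exact hmem

/-- Without cycles the rows of the reduced incidence matrix are linearly independent: the indicator
of one side of the cut left by the deletion of `e` is orthogonal to all rows but that of `e`. -/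
theorem linearIndependent_redIncidence (hl : ∀ e, lab e ∈ H.edgeSet →
      H.IsLink (lab e) (pt (s e)) (pt (t e))) (hlab : Function.Injective lab)
    (hH : ¬ HasCycle H) :
    LinearIndependent ℤ (fun e : {e | lab e ∈ H.edgeSet} => (redIncidence s t).row e) := by
  classical
  rw [linearIndependent_iff']
  intro T c hc e₀ he₀
  by_contra hne
  refine hH (hasCycle_of_reflTransGen_deleteEdges (hl e₀ e₀.2) ?_)
  by_contra hK
  let φ : Option N → ℤ := fun o => if Relation.ReflTransGen
    (H.deleteEdges {lab e₀}).Adj (pt (s e₀)) (pt o) then 1 else 0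
  have h1 : ∑ e ∈ T, c e * (φ (s e) - φ (t e)) = 0 := by
    have := congrArg (fun r : N → ℤ => ∑ v, r v * (φ (some v) - φ none)) hc
    simp only [Finset.sum_apply, Pi.smul_apply, Finset.sum_mul, Pi.zero_apply, zero_mul,
      Finset.sum_const_zero] at this
    rw [Finset.sum_comm] at this
    rw [← this]
    refine Finset.sum_congr rfl fun e _ => ?_
    rw [← redIncidence_mulVec]
    simp [Matrix.mulVec, dotProduct, Finset.mul_sum, mul_assoc]
  rw [Finset.sum_eq_single_of_mem e₀ he₀] at h1
  · have hs : φ (s e₀) = 1 := if_pos Relation.ReflTransGen.refl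
    have ht : φ (t e₀) = 0 := if_neg hK
    rw [hs, ht] at h1
    simp at h1
    exact hne h1
  · intro e _ hee
    have hlink : (H.deleteEdges {lab e₀}).IsLink (lab e) (pt (s e)) (pt (t e)) := by
      have : lab e ≠ lab e₀ := fun h => hee (Subtype.ext (hlab h))
      simp [hl e e.2, this]
    have : φ (s e) = φ (t e) := by
      simp only [φ]
      congr 1
      exact propext ⟨fun h => h.tail ⟨_, hlink⟩, fun h => h.tail ⟨_, hlink.symm⟩⟩
    rw [this, sub_self, mul_zero]

/-- A nonsingular square submatrix of the reduced incidence matrix certifies connectedness: the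
indicator of a union of components avoiding the root is in the kernel. -/
theorem connected_of_det_redIncidence_ne_zero (hV : Set.range pt = H.vertexSet)
    (f : N → E) (hl : ∀ i, H.IsLink (lab (f i)) (pt (s (f i))) (pt (t (f i))))
    (hdet : ((redIncidence s t).submatrix f id).det ≠ 0) : Connected H := by
  classical
  let φ : Option N → ℤ := fun o =>
    if Relation.ReflTransGen H.Adj (pt none) (pt o) then 1 else 0
  have hker : ((redIncidence s t).submatrix f id).mulVec (fun v => φ (some v) - φ none) = 0 := by
    ext i
    have : φ (s (f i)) = φ (t (f i)) := by
      simp only [φ]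
      congr 1
      exact propext ⟨fun h => h.tail ⟨_, hl i⟩, fun h => h.tail ⟨_, (hl i).symm⟩⟩
    exact (redIncidence_mulVec s t φ (f i)).trans (sub_eq_zero.2 this)
  have h0 := Matrix.eq_zero_of_mulVec_eq_zero hdet hker
  have hnone : φ none = 1 := if_pos Relation.ReflTransGen.refl
  have hroot : ∀ o, Relation.ReflTransGen H.Adj (pt none) (pt o) := by
    intro o
    by_contra ho
    have h1 : φ o = 0 := if_neg ho
    cases o with
    | none => exact ho Relation.ReflTransGen.refl
    | some v =>
      have := congrFun h0 v
      simp [h1, hnone] at this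
  refine ⟨⟨pt none, hV ▸ ⟨_, rfl⟩⟩, ?_⟩
  rw [← hV]
  rintro _ ⟨o, rfl⟩ _ ⟨o', rfl⟩
  exact (Std.Symm.symm _ _ (hroot o)).trans (hroot o')

/-- A nonsingular square submatrix of the reduced incidence matrix certifies the absence of cycles:
the signed sum of the rows along a cycle is zero. -/
theorem not_hasCycle_of_det_redIncidence_ne_zero (hpt : Function.Injective pt)
    (f : N → E) (hE : H.edgeSet ⊆ Set.range (lab ∘ f))
    (hl : ∀ i, H.IsLink (lab (f i)) (pt (s (f i))) (pt (t (f i))))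
    (hdet : ((redIncidence s t).submatrix f id).det ≠ 0) : ¬ HasCycle H := by
  classical
  rintro ⟨m, v, e, -, he, hlink⟩
  choose k hk using fun i => hE (hlink i).edge_mem
  have hkinj : Function.Injective k := fun i j hij => he (by rw [← hk i, ← hk j, hij])
  let δ : α → N → ℤ := fun x w => if x = pt (some w) then 1 else 0
  have hrow (i : N) : (redIncidence s t).row (f i) = δ (pt (s (f i))) - δ (pt (t (f i))) := by
    ext w
    simp [redIncidence, δ, hpt.eq_iff]
  have hsign (i) : ∃ ε : ℤ, ε ≠ 0 ∧
      ε • (redIncidence s t).row (f (k i)) = δ (v i) - δ (v (i + 1)) := by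
    have h1 := hl (k i)
    have h2 := hlink i
    rw [← hk i] at h2
    rcases h1.eq_and_eq_or_eq_and_eq h2 with ⟨h, h'⟩ | ⟨h, h'⟩
    · exact ⟨1, one_ne_zero, by rw [hrow, h, h', one_smul]⟩
    · exact ⟨-1, by norm_num, by rw [hrow, h, h', neg_smul, one_smul, neg_sub]⟩
  choose ε hε hεrow using hsign
  have hsum : ∑ i, ε i • (redIncidence s t).row (f (k i)) = 0 := by
    simp only [hεrow, Finset.sum_sub_distrib]
    exact sub_eq_zero.2 (Equiv.sum_comp (Equiv.addRight (1 : Fin (m + 1))) fun i => δ (v i)).symm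
  have hli : LinearIndependent ℤ (fun i => (redIncidence s t).row (f i)) :=
    Matrix.linearIndependent_rows_of_det_ne_zero hdet
  exact hε 0 (Fintype.linearIndependent_iff.1 (hli.comp k hkinj) ε hsum 0)

end

/-- The matrix tree theorem: the number of spanning trees of a finite multigraph is the determinant
of its reduced Laplacian. The vertices are enumerated by `Option N`, the edges by `E`. -/
theorem numSpanningTrees_eq_det {E N : Type*} [Fintype E] [Fintype N] [DecidableEq N]
    {G : Graph α β} {pt : Option N → α} {lab : E → β} {s t : E → Option N}
    (hpt : Function.Injective pt) (hV : Set.range pt = G.vertexSet)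
    (hlab : Function.Injective lab) (hE : Set.range lab = G.edgeSet)
    (hl : ∀ e, G.IsLink (lab e) (pt (s e)) (pt (t e))) :
    (numSpanningTrees G : ℤ) = ((redIncidence s t).transpose * redIncidence s t).det := by
  classical
  let sub : Finset E → Graph α β := fun S => G.restrict (lab '' S)
  have hsubE (S : Finset E) : (sub S).edgeSet = lab '' S := by
    simp only [sub, Graph.edgeSet_restrict, ← hE]
    exact Set.inter_eq_right.2 (Set.image_subset_range _ _)
  have hsubV (S : Finset E) : (sub S).vertexSet = G.vertexSet := rfl
  have hsublink (S : Finset E) (e : E) (he : lab e ∈ (sub S).edgeSet) :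
      (sub S).IsLink (lab e) (pt (s e)) (pt (t e)) :=
    (Graph.restrict_le.isLink_iff he).2 (hl e)
  have hmem (S : Finset E) (e : E) : lab e ∈ (sub S).edgeSet ↔ e ∈ S := by
    rw [hsubE, hlab.mem_set_image, Finset.mem_coe]
  have hsubinj : Function.Injective sub := by
    intro S S' h
    ext e
    rw [← hmem, ← hmem, h]
  let trees : Finset (Finset E) := Finset.univ.filter fun S => IsTree (sub S)
  have hcount : numSpanningTrees G = trees.card := by
    have : {H : Graph α β | H.IsSpanningSubgraph G ∧ IsTree H} =
        sub '' (trees : Set (Finset E)) := by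
      ext H
      constructor
      · rintro ⟨hH, hT⟩
        have hHS : sub (Finset.univ.filter fun e => lab e ∈ H.edgeSet) = H := by
          have hle : H.edgeSet ⊆ Set.range lab := hE ▸ hH.le.edgeSet_mono
          have hE' : (sub (Finset.univ.filter fun e => lab e ∈ H.edgeSet)).edgeSet = H.edgeSet := by
            rw [hsubE]
            ext x
            constructor
            · rintro ⟨e, he, rfl⟩
              simpa using he
            · intro hx
              obtain ⟨e, rfl⟩ := hle hx
              exact ⟨e, by simpa using hx, rfl⟩
          exact Graph.Compatible.ext hH.vertexSet_eq.symm hE'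
            (Graph.Compatible.of_le_le Graph.restrict_le hH.le)
        exact ⟨_, by simpa [trees, hHS] using hT, hHS⟩
      · rintro ⟨S, hS, rfl⟩
        exact ⟨⟨Graph.restrict_le, rfl⟩, by simpa [trees] using hS⟩
    rw [numSpanningTrees, this, Set.ncard_image_of_injective _ hsubinj, Set.ncard_coe_finset]
  -- The rows of a spanning tree form a basis of the lattice `N → ℤ`.
  have hbasis (S : Finset E) (hS : S ∈ trees) :
      LinearIndependent ℤ (fun e : S => (redIncidence s t).row e) ∧
      Submodule.span ℤ (Set.range fun e : S => (redIncidence s t).row e) = ⊤ := by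
    have hT : IsTree (sub S) := by simpa [trees] using hS
    have hset : {e | lab e ∈ (sub S).edgeSet} = (S : Set E) := by ext e; simp [hmem]
    have h1 := linearIndependent_redIncidence (hsublink S) hlab hT.2
    have h2 := span_redIncidence_eq_top hpt (by rw [hV, hsubV])
      (by rw [hsubE]; exact Set.image_subset_range _ _) (hsublink S) hT.1
    rw [hset] at h1 h2
    refine ⟨h1, ?_⟩
    rw [← h2, Set.image_eq_range]
    rfl
  have hcard (S : Finset E) (hS : S ∈ trees) : S.card = Fintype.card N := by
    have b := Module.Basis.mk (hbasis S hS).1 (hbasis S hS).2.ge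
    have := Module.finrank_eq_card_basis b
    simpa using this.symm
  -- A square minor is `±1` if its rows are, in some order, the edges of a spanning tree, and `0`
  -- otherwise.
  let good : Finset (N → E) := Finset.univ.filter fun f =>
    Function.Injective f ∧ Finset.univ.image f ∈ trees
  have hdet (f : N → E) : ((redIncidence s t).submatrix f id).det ^ 2 =
      if f ∈ good then 1 else 0 := by
    split_ifs with hf
    · obtain ⟨hinj, hS⟩ : Function.Injective f ∧ Finset.univ.image f ∈ trees := by
        simpa [good] using hf
      let g : N ≃ (Finset.univ.image f : Finset E) :=
        Equiv.ofBijective (fun i => ⟨f i, by simp⟩)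
          ⟨fun i j h => hinj (congrArg Subtype.val h), fun ⟨e, he⟩ => by simpa using he⟩
      have hunit : IsUnit ((Pi.basisFun ℤ N).det fun i => (redIncidence s t).row (f i)) := by
        rw [← Module.Basis.is_basis_iff_det]
        refine ⟨(hbasis _ hS).1.comp g g.injective, ?_⟩
        rw [← (hbasis _ hS).2, ← g.surjective.range_comp]
        rfl
      rw [Module.Basis.det_apply, ← Matrix.det_transpose] at hunit
      have heq : ((Pi.basisFun ℤ N).toMatrix fun i => (redIncidence s t).row (f i)).transpose =
          (redIncidence s t).submatrix f id := by
        ext i j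
        simp [Module.Basis.toMatrix_apply]
      rw [heq] at hunit
      rcases Int.isUnit_iff.1 hunit with h | h <;> simp [h]
    · rw [sq_eq_zero_iff]
      by_contra hne
      apply hf
      have hli : LinearIndependent ℤ (fun i => (redIncidence s t).row (f i)) :=
        Matrix.linearIndependent_rows_of_det_ne_zero hne
      have hlink (i : N) : (sub (Finset.univ.image f)).IsLink (lab (f i)) (pt (s (f i)))
          (pt (t (f i))) := hsublink _ _ ((hmem _ _).2 (by simp))
      have hT : IsTree (sub (Finset.univ.image f)) :=
        ⟨connected_of_det_redIncidence_ne_zero (by rw [hV, hsubV]) f hlink hne,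
          not_hasCycle_of_det_redIncidence_ne_zero hpt f
            (by rw [hsubE, Finset.coe_image, Finset.coe_univ, Set.image_univ, Set.range_comp])
            hlink hne⟩
      have hinj : Function.Injective f := fun i j hij => hli.injective (by simp [hij])
      simpa [good, trees] using ⟨hinj, hT⟩
  -- Each spanning tree is enumerated by `N` in `(card N)!` ways.
  have hgood : good.card = trees.card * (Fintype.card N).factorial := by
    rw [Finset.card_eq_sum_card_fiberwise (t := trees) (f := fun f => Finset.univ.image f)
      (fun f hf => by simp [good] at hf; exact hf.2)]
    rw [Finset.sum_const_nat fun S hS => ?_]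
    have hemb : Fintype.card (N ↪ S) = (Fintype.card N).factorial := by
      rw [Fintype.card_embedding_eq, Fintype.card_coe, hcard S hS, Nat.descFactorial_self]
    rw [← hemb, ← Finset.card_univ]
    symm
    refine Finset.card_bij (fun g _ i => (g i : E)) ?_ ?_ ?_
    · intro g _
      have hinj : Function.Injective fun i => (g i : E) := Subtype.val_injective.comp g.injective
      have himg : Finset.univ.image (fun i => (g i : E)) = S := by
        refine Finset.eq_of_subset_of_card_le (fun e he => ?_) ?_
        · obtain ⟨i, -, rfl⟩ := Finset.mem_image.1 he
          exact (g i).2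
        · rw [Finset.card_image_of_injective _ hinj, hcard S hS, Finset.card_univ]
      simp only [good, Finset.mem_filter, Finset.mem_univ, true_and]
      exact ⟨⟨hinj, by rwa [himg]⟩, himg⟩
    · intro g _ g' _ h
      ext i
      exact congrFun h i
    · intro f hf
      simp only [good, Finset.mem_filter, Finset.mem_univ, true_and] at hf
      obtain ⟨⟨hinj, -⟩, rfl⟩ := hf
      exact ⟨⟨fun i => ⟨f i, by simp⟩, fun i j h => hinj (congrArg Subtype.val h)⟩, by simp, rfl⟩
  have hCB := Matrix.factorial_mul_det_transpose_mul_self (redIncidence s t)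
  rw [Finset.sum_congr rfl fun f _ => hdet f, Finset.sum_ite_mem, Finset.univ_inter,
    Finset.sum_const, hgood, nsmul_one, Nat.cast_mul, mul_comm] at hCB
  rw [hcount]
  exact (mul_right_cancel₀ (by exact_mod_cast Nat.factorial_ne_zero _) hCB).symm

end Multigraph

/-! ### The cells in barycentric coordinates -/

namespace SelfSimilar

/-- The last letter of a word acts first. -/
theorem wordMap_succ_eq_init {X ι : Type*} (f : ι → X → X) :
    ∀ (n : ℕ) (ω : Fin (n + 1) → ι) (x : X),
      wordMap f (n + 1) ω x = wordMap f n (Fin.init ω) (f (ω (Fin.last n)) x)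
  | 0, _, _ => rfl
  | n + 1, ω, x => by
    have h := wordMap_succ_eq_init f n (Fin.tail ω) x
    rw [← Fin.tail_init_eq_init_tail] at h
    exact congrArg (f (ω 0)) h

end SelfSimilar

namespace NonPCFGasket

open SelfSimilar

/-- The point of the plane with barycentric coordinates `b` (when these sum to `1`). -/
noncomputable def ofBary (b : Fin 3 → ℝ) : Plane := ∑ i, b i • corner i

theorem bary_ofBary {b : Fin 3 → ℝ} (hb : ∑ i, b i = 1) : bary (ofBary b) = b := by
  have h3 : (√3 : ℝ) ≠ 0 := by positivity
  rw [Fin.sum_univ_three] at hb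
  ext i
  fin_cases i <;> simp [bary, ofBary, corner, Fin.sum_univ_three] <;> field_simp <;> linarith

theorem sum_bary (x : Plane) : ∑ i, bary x i = 1 := by
  simp [bary, Fin.sum_univ_three]
  ring

theorem ofBary_bary (x : Plane) : ofBary (bary x) = x := by
  have h3 : (√3 : ℝ) ≠ 0 := by positivity
  ext i
  fin_cases i <;> simp [bary, ofBary, corner, Fin.sum_univ_three] <;> field_simp
  ring

theorem bary_injective : Function.Injective bary := fun x y h => by
  rw [← ofBary_bary x, h, ofBary_bary]

theorem bary_corner (a : Fin 3) : bary (corner a) = Pi.single a 1 := by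
  have : corner a = ofBary (Pi.single a 1) := by
    simp [ofBary, Pi.single_apply]
  rw [this, bary_ofBary (by simp)]

theorem bary_triSymm (σ : Equiv.Perm (Fin 3)) (x : Plane) (i : Fin 3) :
    bary (triSymm σ x) (σ i) = bary x i := by
  have : triSymm σ x = ofBary (fun i => bary x (σ.symm i)) := by
    simpa [triSymm, ofBary] using
      Equiv.sum_comp σ fun i => bary x (σ.symm i) • corner i
  rw [this, bary_ofBary]
  · simp
  · rw [← sum_bary x]
    exact Equiv.sum_comp σ.symm _

/-- The map `baseMap` in barycentric coordinates. -/
noncomputable def baryStep (b : Fin 3 → ℝ) : Fin 3 → ℝ :=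
  ![b 0 + 5 / 12 * b 1 + b 2 / 3, 5 / 12 * b 1 + b 2 / 3, b 1 / 6 + b 2 / 3]

theorem bary_baseMap (x : Plane) : bary (baseMap x) = baryStep (bary x) := by
  have h3 : (√3 : ℝ) ≠ 0 := by positivity
  have hs : (√3 : ℝ) ^ 2 = 3 := Real.sq_sqrt (by norm_num)
  ext i
  fin_cases i <;>
    simp [bary, baseMap, baryStep, Matrix.toLpLin_apply, dotProduct,
      Fin.sum_univ_two] <;> field_simp <;> ring_nf <;> simp only [hs] <;> ring

theorem bary_cellMap (σ : Equiv.Perm (Fin 3)) (x : Plane) (i : Fin 3) :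
    bary (cellMap σ x) (σ i) = baryStep (fun j => bary x (σ j)) i := by
  rw [cellMap, Function.comp_apply, Function.comp_apply, bary_triSymm, bary_baseMap]
  congr 1
  ext j
  simpa using bary_triSymm σ⁻¹ x (σ j)

theorem baryStep_injective : Function.Injective baryStep := by
  intro b b' h
  have h0 := congrFun h 0
  have h1 := congrFun h 1
  have h2 := congrFun h 2
  simp [baryStep] at h0 h1 h2
  ext i
  fin_cases i <;> simp <;> linarith

theorem cellMap_injective (σ : Equiv.Perm (Fin 3)) : Function.Injective (cellMap σ) := by
  intro x y h
  have h1 : (fun j => bary x (σ j)) = fun j => bary y (σ j) := by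
    apply baryStep_injective
    ext i
    rw [← bary_cellMap, ← bary_cellMap, h]
  apply bary_injective
  ext i
  simpa using congrFun h1 (σ.symm i)

/-- The interior of the triangle. -/
def openTriangle : Set Plane := {x | ∀ i, 0 < bary x i}

/-- The triangle. -/
def closedTriangle : Set Plane := {x | ∀ i, 0 ≤ bary x i}

theorem openTriangle_subset : openTriangle ⊆ closedTriangle := fun _ hx i => (hx i).le

theorem cellMap_mem_openTriangle (σ : Equiv.Perm (Fin 3)) {x : Plane} (hx : x ∈ openTriangle) :
    cellMap σ x ∈ openTriangle := by
  intro i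
  obtain ⟨j, rfl⟩ := σ.surjective i
  have h0 := hx (σ 0)
  have h1 := hx (σ 1)
  have h2 := hx (σ 2)
  rw [bary_cellMap]
  fin_cases j <;> simp [baryStep] <;> positivity

theorem cellMap_mem_closedTriangle (σ : Equiv.Perm (Fin 3)) {x : Plane}
    (hx : x ∈ closedTriangle) : cellMap σ x ∈ closedTriangle := by
  intro i
  obtain ⟨j, rfl⟩ := σ.surjective i
  have h0 := hx (σ 0)
  have h1 := hx (σ 1)
  have h2 := hx (σ 2)
  rw [bary_cellMap]
  fin_cases j <;> simp [baryStep] <;> positivity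

theorem wordMap_mem_openTriangle {x : Plane} (hx : x ∈ openTriangle) :
    ∀ (n : ℕ) (ω : Fin n → Equiv.Perm (Fin 3)), wordMap cellMap n ω x ∈ openTriangle
  | 0, _ => hx
  | n + 1, ω => cellMap_mem_openTriangle _ (wordMap_mem_openTriangle hx n (Fin.tail ω))

theorem wordMap_mem_closedTriangle {x : Plane} (hx : x ∈ closedTriangle) :
    ∀ (n : ℕ) (ω : Fin n → Equiv.Perm (Fin 3)), wordMap cellMap n ω x ∈ closedTriangle
  | 0, _ => hx
  | n + 1, ω => cellMap_mem_closedTriangle _ (wordMap_mem_closedTriangle hx n (Fin.tail ω))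

/-- The image of the open triangle under `cellMap σ` lies in the open chamber in which the
barycentric coordinates decrease strictly along `σ`. -/
theorem strictAnti_bary_cellMap (σ : Equiv.Perm (Fin 3)) {x : Plane} (hx : x ∈ openTriangle) :
    StrictAnti fun i => bary (cellMap σ x) (σ i) := by
  have h0 := hx (σ 0)
  have h1 := hx (σ 1)
  simp only [bary_cellMap]
  refine Fin.strictAnti_iff_succ_lt.2 fun i => ?_
  fin_cases i <;> simp [baryStep] <;> linarith

theorem antitone_bary_cellMap (σ : Equiv.Perm (Fin 3)) {x : Plane} (hx : x ∈ closedTriangle) :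
    Antitone fun i => bary (cellMap σ x) (σ i) := by
  have h0 := hx (σ 0)
  have h1 := hx (σ 1)
  simp only [bary_cellMap]
  refine Fin.antitone_iff_succ_le.2 fun i => ?_
  fin_cases i <;> simp [baryStep] <;> linarith

/-- The six chambers are disjoint, so an open cell of level one meets no other closed one. -/
theorem cellMap_eq_cellMap {σ σ' : Equiv.Perm (Fin 3)} {x y : Plane} (hx : x ∈ openTriangle)
    (hy : y ∈ closedTriangle) (h : cellMap σ x = cellMap σ' y) : σ = σ' ∧ x = y := by
  have hσ : σ = σ' := by
    have h1 := strictAnti_bary_cellMap σ hx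
    have h2 := antitone_bary_cellMap σ' hy
    rw [h] at h1
    have hmono : StrictMono (σ⁻¹ * σ') := by
      refine Monotone.strictMono_of_injective (fun i j hij => ?_) (σ⁻¹ * σ').injective
      rw [← h1.le_iff_ge]
      simpa using h2 hij
    have hid : ∀ τ : Equiv.Perm (Fin 3), (∀ i j, i < j → τ i < τ j) → τ = 1 := by decide
    exact inv_mul_eq_one.1 (hid _ fun i j hij => hmono hij)
  subst hσ
  exact ⟨rfl, cellMap_injective σ h⟩

/-- An open cell of level `n` is disjoint from every other closed cell of level `n`, and each
word acts injectively. Hence the new vertices of different cells are different, and they are not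
vertices of an earlier level. -/
theorem wordMap_eq_wordMap {x y : Plane} (hx : x ∈ openTriangle) (hy : y ∈ closedTriangle) :
    ∀ (n : ℕ) (ω ω' : Fin n → Equiv.Perm (Fin 3)),
      wordMap cellMap n ω x = wordMap cellMap n ω' y → ω = ω' ∧ x = y
  | 0, _, _, h => ⟨Subsingleton.elim _ _, h⟩
  | n + 1, ω, ω', h => by
    obtain ⟨h0, h1⟩ := cellMap_eq_cellMap (wordMap_mem_openTriangle hx n (Fin.tail ω))
      (wordMap_mem_closedTriangle hy n (Fin.tail ω')) h
    obtain ⟨ht, hxy⟩ := wordMap_eq_wordMap hx hy n _ _ h1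
    refine ⟨?_, hxy⟩
    rw [← Fin.cons_self_tail ω, ← Fin.cons_self_tail ω', h0, ht]

/-! ### Enumeration of the vertices -/

/-- The four points of `V₁` that are not corners: the point with index `k < 3` is opposite to the
corner `k`, the point with index `3` is the centre. -/
noncomputable def innerPoint (k : Fin 4) : Plane :=
  ofBary (![![1 / 6, 5 / 12, 5 / 12], ![5 / 12, 1 / 6, 5 / 12], ![5 / 12, 5 / 12, 1 / 6],
    ![1 / 3, 1 / 3, 1 / 3]] k)

theorem bary_innerPoint (k : Fin 4) : bary (innerPoint k) =
    ![![1 / 6, 5 / 12, 5 / 12], ![5 / 12, 1 / 6, 5 / 12], ![5 / 12, 5 / 12, 1 / 6],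
      ![1 / 3, 1 / 3, 1 / 3]] k := by
  apply bary_ofBary
  fin_cases k <;> simp [Fin.sum_univ_three] <;> norm_num

theorem innerPoint_mem_openTriangle (k : Fin 4) : innerPoint k ∈ openTriangle := by
  intro i
  rw [bary_innerPoint]
  fin_cases k <;> fin_cases i <;> simp

theorem innerPoint_injective : Function.Injective innerPoint := by
  intro k l h
  have h' := congrArg bary h
  rw [bary_innerPoint, bary_innerPoint] at h'
  have h0 := congrFun h' 0
  have h1 := congrFun h' 1
  clear h h'
  revert h0 h1
  fin_cases k <;> fin_cases l <;> norm_num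

theorem corner_mem_closedTriangle (a : Fin 3) : corner a ∈ closedTriangle := by
  intro i
  rw [bary_corner, Pi.single_apply]
  split_ifs <;> norm_num

theorem corner_notMem_openTriangle (a : Fin 3) : corner a ∉ openTriangle := by
  intro h
  have h1 := h (a + 1)
  rw [bary_corner, Pi.single_eq_of_ne (by fin_cases a <;> decide)] at h1
  exact lt_irrefl _ h1

/-- The vertex of `V₁`, a corner or an inner point, to which `cellMap σ` sends the corner `a`. -/
def childVertex (σ : Equiv.Perm (Fin 3)) (a : Fin 3) : Fin 3 ⊕ Fin 4 :=
  ![Sum.inl a, Sum.inr (σ 2).castSucc, Sum.inr 3] (σ.symm a)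

theorem cellMap_corner (σ : Equiv.Perm (Fin 3)) (a : Fin 3) :
    cellMap σ (corner a) = Sum.elim corner innerPoint (childVertex σ a) := by
  apply bary_injective
  ext i
  obtain ⟨a, rfl⟩ := σ.surjective a
  obtain ⟨i, rfl⟩ := σ.surjective i
  rw [bary_cellMap, bary_corner]
  have hs (j : Fin 3) : (Pi.single (σ a) (1 : ℝ) : Fin 3 → ℝ) (σ j) =
      (Pi.single a (1 : ℝ) : Fin 3 → ℝ) j := by
    simp [Pi.single_apply]
  simp only [hs]
  have hq (k j : Fin 3) : bary (innerPoint k.castSucc) j = if j = k then 1 / 6 else 5 / 12 := by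
    rw [bary_innerPoint]
    fin_cases k <;> fin_cases j <;> simp
  have hc (j : Fin 3) : bary (innerPoint 3) j = 1 / 3 := by
    rw [bary_innerPoint]
    fin_cases j <;> simp
  fin_cases a
  · simp only [childVertex, Equiv.symm_apply_apply]
    fin_cases i <;> simp [baryStep, bary_corner]
  · simp only [childVertex, Equiv.symm_apply_apply]
    fin_cases i <;> simp [baryStep, hq]
  · simp only [childVertex, Equiv.symm_apply_apply]
    fin_cases i <;> simp [baryStep, hc]

/-- Labels for the vertices of `G n` other than the corner `0`, which is the root: each of the
cells of level `n` contributes four new vertices to `V (n + 1)`. -/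
def Label : ℕ → Type
  | 0 => Fin 2
  | n + 1 => Label n ⊕ ((Fin n → Equiv.Perm (Fin 3)) × Fin 4)

instance instFintypeLabel : (n : ℕ) → Fintype (Label n)
  | 0 => inferInstanceAs (Fintype (Fin 2))
  | n + 1 =>
    haveI := instFintypeLabel n
    inferInstanceAs (Fintype (Label n ⊕ ((Fin n → Equiv.Perm (Fin 3)) × Fin 4)))

instance instDecidableEqLabel : (n : ℕ) → DecidableEq (Label n)
  | 0 => inferInstanceAs (DecidableEq (Fin 2))
  | n + 1 =>
    haveI := instDecidableEqLabel n
    inferInstanceAs (DecidableEq (Label n ⊕ ((Fin n → Equiv.Perm (Fin 3)) × Fin 4)))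

/-- The inclusion of `V n` into `V (n + 1)` on labels. -/
def oldLabel {n : ℕ} (o : Option (Label n)) : Option (Label (n + 1)) := o.map Sum.inl

/-- The label of the new vertex `k` in the cell `ω`. -/
def newLabel {n : ℕ} (ω : Fin n → Equiv.Perm (Fin 3)) (k : Fin 4) : Option (Label (n + 1)) :=
  some (Sum.inr (ω, k))

theorem label_cases {n : ℕ} (o : Option (Label (n + 1))) :
    (∃ o', o = oldLabel o') ∨ ∃ ω k, o = newLabel ω k := by
  rcases o with _ | v | ⟨ω, k⟩
  · exact Or.inl ⟨none, rfl⟩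
  · exact Or.inl ⟨some v, rfl⟩
  · exact Or.inr ⟨ω, k, rfl⟩

/-- The point with a given label. -/
noncomputable def point : (n : ℕ) → Option (Label n) → Plane
  | 0, none => corner 0
  | 0, some i => corner (Fin.succ (n := 2) i)
  | _ + 1, none => corner 0
  | n + 1, some (Sum.inl v) => point n (some v)
  | n + 1, some (Sum.inr (ω, k)) => wordMap cellMap n ω (innerPoint k)

theorem point_oldLabel {n : ℕ} (o : Option (Label n)) :
    point (n + 1) (oldLabel o) = point n o := by
  rcases o with _ | v
  · cases n <;> rfl
  · rfl

theorem point_newLabel {n : ℕ} (ω : Fin n → Equiv.Perm (Fin 3)) (k : Fin 4) :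
    point (n + 1) (newLabel ω k) = wordMap cellMap n ω (innerPoint k) := rfl

/-- The label of the vertex `F_ω (p_a)`. -/
def cellLabel : (n : ℕ) → (Fin n → Equiv.Perm (Fin 3)) → Fin 3 → Option (Label n)
  | 0, _, a => Fin.cases (motive := fun _ => Option (Fin 2)) none some a
  | n + 1, ω, a => Sum.elim (fun b => oldLabel (cellLabel n (Fin.init ω) b))
      (newLabel (Fin.init ω)) (childVertex (ω (Fin.last n)) a)

theorem point_cellLabel : ∀ (n : ℕ) (ω : Fin n → Equiv.Perm (Fin 3)) (a : Fin 3),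
    point n (cellLabel n ω a) = wordMap cellMap n ω (corner a)
  | 0, _, a => by fin_cases a <;> rfl
  | n + 1, ω, a => by
    rw [wordMap_succ_eq_init, cellMap_corner, cellLabel]
    rcases childVertex (ω (Fin.last n)) a with b | k
    · exact (point_oldLabel _).trans (point_cellLabel n _ b)
    · rfl

/-- Every label is the label of a vertex of a cell. -/
theorem exists_cellLabel_eq : ∀ (n : ℕ) (o : Option (Label n)),
    ∃ ω a, cellLabel n ω a = o
  | 0, none => ⟨Fin.elim0, 0, rfl⟩
  | 0, some i => ⟨Fin.elim0, Fin.succ (n := 2) i, rfl⟩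
  | n + 1, o => by
    rcases label_cases o with ⟨o, rfl⟩ | ⟨ω, k, rfl⟩
    · obtain ⟨ω, a, rfl⟩ := exists_cellLabel_eq n o
      refine ⟨Fin.snoc (α := fun _ => Equiv.Perm (Fin 3)) ω (Equiv.swap 0 a), a, ?_⟩
      simp [cellLabel, childVertex, Fin.init_snoc, Fin.snoc_last]
    · have hk : ∃ σ a, childVertex σ a = Sum.inr k := by
        revert k
        decide
      obtain ⟨σ, a, h⟩ := hk
      refine ⟨Fin.snoc (α := fun _ => Equiv.Perm (Fin 3)) ω σ, a, ?_⟩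
      simp [cellLabel, Fin.init_snoc, Fin.snoc_last, h]

theorem point_injective : ∀ n, Function.Injective (point n)
  | 0 => by
    have hc : Function.Injective corner := fun a b h => by
      have := congrFun (congrArg bary h) a
      rw [bary_corner, bary_corner, Pi.single_eq_same, Pi.single_apply] at this
      by_contra hne
      rw [if_neg hne] at this
      exact one_ne_zero this
    intro o o' h
    rcases o with _ | i <;> rcases o' with _ | j
    · rfl
    · exact absurd (hc h) (Fin.succ_ne_zero j).symm
    · exact absurd (hc h) (Fin.succ_ne_zero i)
    · exact congrArg some (Fin.succ_injective _ (hc h))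
  | n + 1 => by
    have hne (o : Option (Label n)) (ω : Fin n → Equiv.Perm (Fin 3)) (k : Fin 4) :
        point (n + 1) (newLabel ω k) ≠ point (n + 1) (oldLabel o) := by
      intro h
      obtain ⟨ω', a, rfl⟩ := exists_cellLabel_eq n o
      rw [point_newLabel, point_oldLabel, point_cellLabel] at h
      have := (wordMap_eq_wordMap (innerPoint_mem_openTriangle k)
        (corner_mem_closedTriangle a) n _ _ h).2
      exact corner_notMem_openTriangle a (this ▸ innerPoint_mem_openTriangle k)
    intro o o' h
    rcases label_cases o with ⟨o, rfl⟩ | ⟨ω, k, rfl⟩ <;>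
      rcases label_cases o' with ⟨o', rfl⟩ | ⟨ω', k', rfl⟩
    · rw [point_oldLabel, point_oldLabel] at h
      rw [point_injective n h]
    · exact absurd h.symm (hne _ _ _)
    · exact absurd h (hne _ _ _)
    · obtain ⟨rfl, hk⟩ := wordMap_eq_wordMap (innerPoint_mem_openTriangle k)
        (openTriangle_subset (innerPoint_mem_openTriangle k')) n _ _ h
      rw [innerPoint_injective hk]

theorem range_point (n : ℕ) : Set.range (point n) = (G n).vertexSet := by
  ext x
  constructor
  · rintro ⟨o, rfl⟩
    obtain ⟨ω, a, rfl⟩ := exists_cellLabel_eq n o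
    exact ⟨ω, a, point_cellLabel n ω a⟩
  · rintro ⟨ω, a, rfl⟩
    exact ⟨_, point_cellLabel n ω a⟩

/-! ### The reduced incidence matrix -/

/-- The edges of `G n`, indexed by a word `ω` and the corner `k` opposite to the edge. -/
abbrev EdgeIndex (n : ℕ) : Type := (Fin n → Equiv.Perm (Fin 3)) × Fin 3

/-- The reduced incidence matrix of `G n`, the corner `0` being the root. -/
def incidence (n : ℕ) : Matrix (EdgeIndex n) (Label n) ℤ :=
  Multigraph.redIncidence (fun e => cellLabel n e.1 (e.2 + 1)) (fun e => cellLabel n e.1 (e.2 + 2))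

theorem numSpanningTrees_G (n : ℕ) : (Multigraph.numSpanningTrees (G n) : ℤ) =
    ((incidence n).transpose * incidence n).det := by
  have hne : ∀ k : Fin 3, k + 1 ≠ k + 2 := by decide
  refine Multigraph.numSpanningTrees_eq_det (pt := point n)
    (lab := fun e : EdgeIndex n => (e.1, s(e.2 + 1, e.2 + 2))) (point_injective n) (range_point n)
    ?_ ?_ ?_
  · rintro ⟨ω, k⟩ ⟨ω', k'⟩ h
    have hk : ∀ k k' : Fin 3, s(k + 1, k + 2) = s(k' + 1, k' + 2) → k = k' := by decide
    rw [Prod.mk.injEq] at h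
    exact Prod.ext h.1 (hk _ _ h.2)
  · ext ⟨ω, z⟩
    constructor
    · rintro ⟨⟨ω', k⟩, h⟩
      obtain ⟨rfl, rfl⟩ := Prod.mk.inj h
      exact ⟨_, _, k + 1, k + 2, hne k, rfl, rfl, rfl⟩
    · rintro ⟨_, _, a, b, hab, rfl, -, -⟩
      have hk : ∀ a b : Fin 3, a ≠ b → ∃ k : Fin 3, s(k + 1, k + 2) = s(a, b) := by decide
      obtain ⟨k, hk⟩ := hk a b hab
      exact ⟨(ω, k), by simp [hk]⟩
  · rintro ⟨ω, k⟩
    exact ⟨k + 1, k + 2, hne k, rfl, point_cellLabel n _ _, point_cellLabel n _ _⟩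

end NonPCFGasket

/-! ### The Laplacian in the harmonic basis -/

namespace NonPCFGasket

/-- The bilinear Dirichlet form of the triangle with unit conductances. -/
def triangleForm (f g : Fin 3 → ℚ) : ℚ :=
  ∑ k : Fin 3, (f (k + 1) - f (k + 2)) * (g (k + 1) - g (k + 2))

/-- The bilinear Dirichlet form of the graph `G 1` on its three corners and four inner points. -/
def cellForm (f g : Fin 3 ⊕ Fin 4 → ℚ) : ℚ :=
  ∑ σ : Equiv.Perm (Fin 3), triangleForm (fun a => f (childVertex σ a))
    (fun a => g (childVertex σ a))

/-- The weights of the harmonic extension from the corners of `G 1` to its inner points, which are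
the barycentric coordinates of these points. -/
def harmonicWeight (k : Fin 4) : Fin 3 → ℚ :=
  ![![1 / 6, 5 / 12, 5 / 12], ![5 / 12, 1 / 6, 5 / 12], ![5 / 12, 5 / 12, 1 / 6],
    ![1 / 3, 1 / 3, 1 / 3]] k

theorem sum_perm_three (F : Equiv.Perm (Fin 3) → ℚ) : ∑ σ, F σ =
    F 1 + F (Equiv.swap 0 1) + F (Equiv.swap 0 2) + F (Equiv.swap 1 2) +
      F (Equiv.swap 0 1 * Equiv.swap 1 2) + F (Equiv.swap 1 2 * Equiv.swap 0 1) := by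
  have h : (Finset.univ : Finset (Equiv.Perm (Fin 3))) =
      {1, Equiv.swap 0 1, Equiv.swap 0 2, Equiv.swap 1 2,
        Equiv.swap 0 1 * Equiv.swap 1 2, Equiv.swap 1 2 * Equiv.swap 0 1} := by decide
  rw [h]
  repeat rw [Finset.sum_insert (by decide)]
  rw [Finset.sum_singleton]
  ring

/-- In `G 1` the centre is joined by double edges to the corners and to the other inner points, and
each corner is joined by a simple edge to the two inner points that are not opposite to it. -/
theorem cellForm_eq (f g : Fin 3 ⊕ Fin 4 → ℚ) : cellForm f g =
    2 * ∑ i : Fin 3, (f (Sum.inl i) - f (Sum.inr 3)) * (g (Sum.inl i) - g (Sum.inr 3)) +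
    2 * ∑ k : Fin 3, (f (Sum.inr k.castSucc) - f (Sum.inr 3)) *
      (g (Sum.inr k.castSucc) - g (Sum.inr 3)) +
    ∑ i : Fin 3, ∑ k : Fin 3, if i = k then 0 else
      (f (Sum.inl i) - f (Sum.inr k.castSucc)) * (g (Sum.inl i) - g (Sum.inr k.castSucc)) := by
  have h1 : childVertex 1 = ![Sum.inl 0, Sum.inr 2, Sum.inr 3] := by decide
  have h2 : childVertex (Equiv.swap 0 1) = ![Sum.inr 2, Sum.inl 1, Sum.inr 3] := by decide
  have h3 : childVertex (Equiv.swap 0 2) = ![Sum.inr 3, Sum.inr 0, Sum.inl 2] := by decide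
  have h4 : childVertex (Equiv.swap 1 2) = ![Sum.inl 0, Sum.inr 3, Sum.inr 1] := by decide
  have h5 : childVertex (Equiv.swap 0 1 * Equiv.swap 1 2) =
      ![Sum.inr 3, Sum.inl 1, Sum.inr 0] := by decide
  have h6 : childVertex (Equiv.swap 1 2 * Equiv.swap 0 1) =
      ![Sum.inr 1, Sum.inr 3, Sum.inl 2] := by decide
  rw [cellForm, sum_perm_three, h1, h2, h3, h4, h5, h6]
  simp [triangleForm, Fin.sum_univ_three]
  ring

/-- A harmonic extension is orthogonal to all functions supported on the inner points, and
the trace of the form of `G 1` on the corners is `5/4` times the form of the triangle. -/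
theorem cellForm_harmonic (a b : Fin 3 → ℚ) (w : Fin 4 → ℚ) :
    cellForm (Sum.elim a fun k => ∑ i, harmonicWeight k i * a i) (Sum.elim b w) =
      5 / 4 * triangleForm a b := by
  rw [cellForm_eq]
  simp [triangleForm, harmonicWeight, Fin.sum_univ_three]
  ring

/-- The Laplacian of `G 1` restricted to the inner points. -/
def innerLaplacian : Matrix (Fin 4) (Fin 4) ℚ :=
  !![4, 0, 0, -2; 0, 4, 0, -2; 0, 0, 4, -2; -2, -2, -2, 12]

theorem det_innerLaplacian : innerLaplacian.det = 576 := by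
  simp [innerLaplacian, Matrix.det_succ_row_zero, Fin.sum_univ_succ, Fin.succAbove]
  norm_num

theorem cellForm_inner (k l : Fin 4) :
    cellForm (Sum.elim 0 (Pi.single k 1)) (Sum.elim 0 (Pi.single l 1)) = innerLaplacian k l := by
  rw [cellForm_eq]
  fin_cases k <;> fin_cases l <;>
    simp [innerLaplacian, Fin.sum_univ_three, Pi.single_apply] <;> norm_num

theorem triangleForm_zero_right (f : Fin 3 → ℚ) : triangleForm f 0 = 0 := by
  simp [triangleForm]

theorem cellForm_zero_left (f : Fin 3 ⊕ Fin 4 → ℚ) : cellForm 0 f = 0 := by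
  simp [cellForm, triangleForm]

theorem cellForm_comm (f g : Fin 3 ⊕ Fin 4 → ℚ) : cellForm f g = cellForm g f := by
  simp only [cellForm, triangleForm, mul_comm]

/-- The indicator function of a label. -/
def indicator {n : ℕ} (v : Label n) (o : Option (Label n)) : ℚ := if o = some v then 1 else 0

/-- The reduced Laplacian of `G n`, the corner `0` being the root. -/
def laplacian (n : ℕ) : Matrix (Label n) (Label n) ℚ :=
  ((incidence n).transpose * incidence n).map (Int.castRingHom ℚ)

/-- The rational incidence matrix evaluated on a vector `x`, extended by zero at the root. -/
theorem incidence_mulVec {n : ℕ} (x : Label n → ℚ) (e : EdgeIndex n) :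
    ((incidence n).map (Int.castRingHom ℚ)).mulVec x e =
      (cellLabel n e.1 (e.2 + 1)).elim 0 x - (cellLabel n e.1 (e.2 + 2)).elim 0 x := by
  have h (o : Option (Label n)) :
      ∑ v, (if o = some v then (1 : ℚ) else 0) * x v = o.elim 0 x := by
    cases o <;> simp
  simp only [Matrix.mulVec, dotProduct, incidence, Multigraph.redIncidence, Matrix.map_apply,
    ← h, ← Finset.sum_sub_distrib]
  refine Finset.sum_congr rfl fun v _ => ?_
  simp [sub_mul]

/-- The Laplacian is the Gram matrix of the Dirichlet form: the form of the whole graph is the sum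
of the forms of the triangles. -/
theorem congr_laplacian {n : ℕ} {ι : Type*} (U : Matrix (Label n) ι ℚ) (i j : ι) :
    (U.transpose * laplacian n * U) i j =
      ∑ ω, triangleForm (fun a => (cellLabel n ω a).elim 0 fun v => U v i)
        (fun a => (cellLabel n ω a).elim 0 fun v => U v j) := by
  have h : U.transpose * laplacian n * U =
      (((incidence n).map (Int.castRingHom ℚ)) * U).transpose *
        (((incidence n).map (Int.castRingHom ℚ)) * U) := by
    rw [laplacian, Matrix.map_mul, Matrix.transpose_map, Matrix.transpose_mul]
    simp only [Matrix.mul_assoc]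
  rw [h, Matrix.mul_apply, Fintype.sum_prod_type]
  refine Finset.sum_congr rfl fun ω _ => Finset.sum_congr rfl fun k _ => ?_
  rw [Matrix.transpose_apply]
  exact congrArg₂ _ (incidence_mulVec (fun v => U v i) (ω, k))
    (incidence_mulVec (fun v => U v j) (ω, k))

theorem laplacian_apply {n : ℕ} (v w : Label n) : laplacian n v w =
    ∑ ω, triangleForm (fun a => indicator v (cellLabel n ω a))
        (fun a => indicator w (cellLabel n ω a)) := by
  have h := congr_laplacian (n := n) 1 v w
  rw [Matrix.transpose_one, Matrix.one_mul, Matrix.mul_one] at h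
  rw [h]
  have h1 (o : Option (Label n)) (v : Label n) :
      (o.elim 0 fun u => (1 : Matrix (Label n) (Label n) ℚ) u v) = indicator v o := by
    cases o <;> simp [indicator, Matrix.one_apply]
  simp only [h1]

/-- Each triangle of level `n` is subdivided into a copy of `G 1`. -/
theorem sum_triangleForm_succ (n : ℕ) (φ ψ : Option (Label (n + 1)) → ℚ) :
    ∑ ω, triangleForm (fun a => φ (cellLabel (n + 1) ω a)) (fun a => ψ (cellLabel (n + 1) ω a)) =
      ∑ ω, cellForm
        (Sum.elim (fun a => φ (oldLabel (cellLabel n ω a))) (fun k => φ (newLabel ω k)))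
        (Sum.elim (fun a => ψ (oldLabel (cellLabel n ω a))) (fun k => ψ (newLabel ω k))) := by
  rw [← (Fin.snocEquiv fun _ : Fin (n + 1) => Equiv.Perm (Fin 3)).sum_comp,
    Fintype.sum_prod_type_right]
  refine Finset.sum_congr rfl fun ω _ => Finset.sum_congr rfl fun σ _ => ?_
  have h (χ : Option (Label (n + 1)) → ℚ) (a : Fin 3) :
      χ (cellLabel (n + 1) (Fin.snocEquiv (fun _ => Equiv.Perm (Fin 3)) (σ, ω)) a) =
      Sum.elim (fun a => χ (oldLabel (cellLabel n ω a))) (fun k => χ (newLabel ω k))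
        (childVertex σ a) := by
    have hω : Fin.init (Fin.snocEquiv (fun _ => Equiv.Perm (Fin 3)) (σ, ω)) = ω :=
      Fin.init_snoc (α := fun _ => Equiv.Perm (Fin 3)) σ ω
    rw [cellLabel, hω, Fin.snocEquiv_apply, Fin.snoc_last]
    cases childVertex σ a <;> rfl
  simp only [h]

/-- The matrix of the harmonic extension of functions on `V n` to the new vertices. -/
def harmonicExtension (n : ℕ) : Matrix ((Fin n → Equiv.Perm (Fin 3)) × Fin 4) (Label n) ℚ :=
  fun p v => ∑ i, harmonicWeight p.2 i * indicator v (cellLabel n p.1 i)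

/-- The unipotent change of basis to functions that are harmonic at the new vertices together with
functions supported on the new vertices. -/
def harmonicBasis (n : ℕ) : Matrix (Label (n + 1)) (Label (n + 1)) ℚ :=
  Matrix.fromBlocks 1 0 (harmonicExtension n) 1

theorem det_harmonicBasis (n : ℕ) : (harmonicBasis n).det = 1 := by
  have h := Matrix.det_fromBlocks_zero₁₂ (1 : Matrix (Label n) (Label n) ℚ)
    (harmonicExtension n) (1 : Matrix ((Fin n → Equiv.Perm (Fin 3)) × Fin 4) _ ℚ)
  rw [Matrix.det_one, Matrix.det_one, one_mul] at h
  exact h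

theorem harmonicBasis_old (n : ℕ) (v : Label n) (ω : Fin n → Equiv.Perm (Fin 3)) :
    Sum.elim (fun a => (oldLabel (cellLabel n ω a)).elim 0 fun u => harmonicBasis n u (Sum.inl v))
        (fun k => (newLabel ω k).elim 0 fun u => harmonicBasis n u (Sum.inl v)) =
      Sum.elim (fun a => indicator v (cellLabel n ω a))
        (fun k => ∑ i, harmonicWeight k i * indicator v (cellLabel n ω i)) := by
  ext (a | k)
  · simp only [Sum.elim_inl]
    cases cellLabel n ω a with
    | none => rfl
    | some u =>
      change (1 : Matrix (Label n) (Label n) ℚ) u v = _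
      simp [indicator, Matrix.one_apply]
  · rfl

theorem harmonicBasis_new (n : ℕ) (p : (Fin n → Equiv.Perm (Fin 3)) × Fin 4)
    (ω : Fin n → Equiv.Perm (Fin 3)) :
    Sum.elim (fun a => (oldLabel (cellLabel n ω a)).elim 0 fun u => harmonicBasis n u (Sum.inr p))
        (fun k => (newLabel ω k).elim 0 fun u => harmonicBasis n u (Sum.inr p)) =
      Sum.elim (0 : Fin 3 → ℚ) (if ω = p.1 then Pi.single p.2 1 else 0) := by
  ext (a | k)
  · simp only [Sum.elim_inl]
    cases cellLabel n ω a <;> rfl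
  · change (1 : Matrix ((Fin n → Equiv.Perm (Fin 3)) × Fin 4) _ ℚ) (ω, k) p = _
    obtain ⟨ω', l⟩ := p
    by_cases h : ω = ω' <;> simp [h, Matrix.one_apply, Pi.single_apply]

open Kronecker in
/-- In the harmonic basis the Laplacian of level `n + 1` is block diagonal, and the block of the
harmonic functions is a multiple of the Laplacian of level `n`. -/
theorem harmonicBasis_congr_laplacian (n : ℕ) :
    (harmonicBasis n).transpose * laplacian (n + 1) * harmonicBasis n =
      Matrix.fromBlocks ((5 / 4 : ℚ) • laplacian n) 0 0
        ((1 : Matrix (Fin n → Equiv.Perm (Fin 3)) _ ℚ) ⊗ₖ innerLaplacian) := by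
  ext i j
  rw [congr_laplacian]
  refine (sum_triangleForm_succ n (fun o => o.elim 0 fun u => harmonicBasis n u i)
    (fun o => o.elim 0 fun u => harmonicBasis n u j)).trans ?_
  rcases i with v | p <;> rcases j with w | q
  · simp only [harmonicBasis_old, cellForm_harmonic]
    rw [Matrix.fromBlocks_apply₁₁, Matrix.smul_apply, laplacian_apply, smul_eq_mul,
      Finset.mul_sum]
  · simp only [harmonicBasis_old, harmonicBasis_new, cellForm_harmonic, triangleForm_zero_right]
    simp
  · simp only [harmonicBasis_old, harmonicBasis_new]
    simp only [cellForm_comm (Sum.elim 0 _), cellForm_harmonic, triangleForm_zero_right]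
    simp
  · simp only [harmonicBasis_new]
    rw [Matrix.fromBlocks_apply₂₂, Matrix.kronecker_apply, Finset.sum_eq_single p.1]
    · rw [if_pos rfl]
      by_cases h : p.1 = q.1
      · rw [if_pos h, cellForm_inner, h, Matrix.one_apply_eq, one_mul]
      · rw [if_neg h, Matrix.one_apply_ne h, zero_mul, cellForm_comm, Sum.elim_zero_zero,
          cellForm_zero_left]
    · intro ω _ h
      rw [if_neg h, Sum.elim_zero_zero, cellForm_zero_left]
    · simp

theorem card_label_succ (n : ℕ) :
    Fintype.card (Label (n + 1)) = Fintype.card (Label n) + 6 ^ n * 4 := by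
  have h : Fintype.card (Label (n + 1)) =
      Fintype.card (Label n ⊕ ((Fin n → Equiv.Perm (Fin 3)) × Fin 4)) := rfl
  rw [h]
  simp [Fintype.card_perm, Nat.factorial]

theorem det_laplacian_succ (n : ℕ) : (laplacian (n + 1)).det =
    (5 / 4) ^ Fintype.card (Label n) * (laplacian n).det * 576 ^ 6 ^ n := by
  have h := congrArg Matrix.det (harmonicBasis_congr_laplacian n)
  rw [Matrix.det_mul, Matrix.det_mul, Matrix.det_transpose, det_harmonicBasis, one_mul,
    mul_one] at h
  rw [h]
  refine (Matrix.det_fromBlocks_zero₁₂ _ _ _).trans ?_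
  rw [Matrix.det_smul, Matrix.det_kronecker, Matrix.det_one, one_pow, one_mul,
    det_innerLaplacian]
  simp [Fintype.card_perm, Nat.factorial]

theorem det_laplacian_zero : (laplacian 0).det = 3 := by
  have h : (laplacian 0).det = (!![2, -1; -1, 2] : Matrix (Fin 2) (Fin 2) ℚ).det := by
    congr 1
    ext i j
    rw [laplacian_apply]
    simp only [Finset.univ_unique, Finset.sum_singleton]
    revert i j
    change ∀ i j : Fin 2, triangleForm (fun a => indicator (n := 0) i (cellLabel 0 default a))
        (fun a => indicator (n := 0) j (cellLabel 0 default a)) = _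
    have hval (i : Fin 2) (a : Fin 3) :
        indicator (n := 0) i (cellLabel 0 default a) = if a = i.succ then 1 else 0 := by
      fin_cases i <;> fin_cases a <;> rfl
    intro i j
    simp only [triangleForm, Fin.sum_univ_three, hval]
    have h11 : (1 + 1 : Fin 3) = 2 := rfl
    have h22 : (2 + 2 : Fin 3) = 1 := rfl
    fin_cases i <;> fin_cases j <;> norm_num [Fin.ext_iff, h11, h22]
  rw [h, Matrix.det_fin_two_of]
  norm_num

theorem numSpanningTrees_G_eq_det_laplacian (n : ℕ) :
    (Multigraph.numSpanningTrees (G n) : ℚ) = (laplacian n).det := by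
  have h := congrArg (Int.cast : ℤ → ℚ) (numSpanningTrees_G n)
  rw [Int.cast_natCast] at h
  rw [h, laplacian]
  exact (Int.castRingHom ℚ).map_det _

theorem five_mul_card_label (n : ℕ) : 5 * Fintype.card (Label n) = 4 * 6 ^ n + 6 := by
  induction n with
  | zero => rfl
  | succ n ih =>
    rw [card_label_succ, pow_succ]
    omega

/-- The exponents grow according to `576 = 2⁶ 3²` for each cell of level `n` and a factor `5/4` for
each vertex of `G n` besides the root. -/
theorem exists_exponents (n : ℕ) : ∃ f g h : ℕ,
    (f : ℚ) = 2 / 25 * (11 * 6 ^ n - 30 * n - 11) ∧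
    (g : ℚ) = 1 / 5 * (2 * 6 ^ n + 3) ∧
    (h : ℚ) = 1 / 25 * (4 * 6 ^ n + 30 * n - 4) ∧
    (laplacian n).det = 2 ^ f * 3 ^ g * 5 ^ h := by
  induction n with
  | zero => exact ⟨0, 1, 0, by norm_num, by norm_num, by norm_num, by simp [det_laplacian_zero]⟩
  | succ n ih =>
    obtain ⟨f, g, h, hf, hg, hh, hdet⟩ := ih
    set c := Fintype.card (Label n) with hc
    have hcard : 5 * c = 4 * 6 ^ n + 6 := five_mul_card_label n
    have hone : 1 ≤ 6 ^ n := Nat.one_le_pow _ _ (by norm_num)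
    -- `6 ^ n` cells contribute `2 ^ (6 * 6 ^ n)`, of which `c` factors `1/4` consume `2 ^ (2 * c)`.
    obtain ⟨d, hd⟩ : ∃ d, 6 * 6 ^ n = d + 2 * c := ⟨6 * 6 ^ n - 2 * c, by omega⟩
    have hcard' : 5 * (c : ℚ) = 4 * 6 ^ n + 6 := by exact_mod_cast hcard
    have hd' : 6 * (6 : ℚ) ^ n = d + 2 * c := by exact_mod_cast hd
    refine ⟨f + d, g + 2 * 6 ^ n, h + c, ?_, ?_, ?_, ?_⟩
    · push_cast
      rw [pow_succ, hf]
      linarith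
    · push_cast
      rw [pow_succ, hg]
      ring
    · push_cast
      rw [pow_succ, hh]
      linarith
    · have h576 : (576 : ℚ) ^ 6 ^ n = 2 ^ d * 4 ^ c * 3 ^ (2 * 6 ^ n) := by
        rw [show (576 : ℚ) = 2 ^ 6 * 3 ^ 2 by norm_num, mul_pow, ← pow_mul, ← pow_mul, hd,
          pow_add, pow_mul 2 2 c]
        norm_num
      rw [det_laplacian_succ, ← hc, hdet, h576, div_pow, pow_add, pow_add, pow_add]
      field_simp

end NonPCFGasket

theorem theorem5p2 (n : ℕ) :
    ∃ f g h : ℕ,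
      (f : ℚ) = 2 / 25 * (11 * 6 ^ n - 30 * n - 11) ∧
      (g : ℚ) = 1 / 5 * (2 * 6 ^ n + 3) ∧
      (h : ℚ) = 1 / 25 * (4 * 6 ^ n + 30 * n - 4) ∧
      Multigraph.numSpanningTrees (NonPCFGasket.G n) = 2 ^ f * 3 ^ g * 5 ^ h := by
  obtain ⟨f, g, h, hf, hg, hh, hdet⟩ := NonPCFGasket.exists_exponents n
  refine ⟨f, g, h, hf, hg, hh, ?_⟩
  rw [← NonPCFGasket.numSpanningTrees_G_eq_det_laplacian] at hdet
  exact_mod_cast hdet
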